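/- For positive integers $p,q$, in the Equals-Index problem $\mathrm{EQIDX}_{p,q}$ Alice holds strings $x_1,\dots,x_p\in\{0,1\}^q$, Bob holds a string $y\in\{0,1\}^q$ and an index $j\in\{1,\dots,p\}$, and the value is $1$ if $y=x_j$ and $0$ otherwise. For a function $f:X\times Y\to\{0,1\}$ with $X,Y$ finite, $R^{\to}(f)$ is the minimum, over all one-way private-coin protocols computing $f$ with error at most $1/3$ on every input, of the maximum length of Alice's message (Alice's message is a function of $x$ and a random string $R$; Bob's output is a function of $y$ and the message). In an online Merlin--Arthur (OMA) protocol for $f$, Merlin, who knows $x$ and $y$, sends Bob a string $\mathcal H$ (the honest one being a function of $(x,y)$); then Alice draws a random string $R$ and sends Bob a message depending on $(x,R)$; Bob outputs an element of $\{0,1,\bot\}$ depending on $(y,\mathcal H,\text{message},R)$. The protocol solves $f$ if, whenever $f(x,y)=1$, Bob outputs $1$ with probability at least $2/3$ for the honest $\mathcal H$, and, whenever $f(x,y)=0$, Bob outputs $1$ with probability at most $1/3$ for every string sent by Merlin. Its verification cost is the maximum length of Alice's message over all $(x,R)$, its help cost is the maximum length of the honest $\mathcal H$ over all $(x,y)$,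 and its total cost is their sum. Theorem. Let $(p_i,q_i)$ be any family of pairs of positive integers with $p_i=\Omega(\log q_i)$, the asymptotics being taken along an arbitrary filter on the index set (for example, along a sequence). Then $R^{\to}(\mathrm{EQIDX}_{p_i,q_i})=\Theta(p_i+\log q_i)$, and every family of OMA protocols $\Pi_i$ solving $\mathrm{EQIDX}_{p_i,q_i}$ that is non-trivial, meaning that the verification cost of $\Pi_i$ is $o(R^{\to}(\mathrm{EQIDX}_{p_i,q_i}))$, has total cost $\omega(q_i)$. In other words, the non-trivial OMA complexity of $\mathrm{EQIDX}_{p,q}$ is $\omega(q)$ whenever $p=\Omega(\log q)$. -/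

import Mathlib

open Filter Asymptotics

/-- A one-way private-coin protocol for inputs `x : X` (Alice) and `y : Y` (Bob): Alice draws a
random string `R` of `coinLen` bits from the distribution `coins`, sends Bob the bit string
`msg x R`, and Bob, who does not see `R`, outputs the bit `out y (msg x R)`. -/
structure PrivateCoinProtocol (X Y : Type*) where
  coinLen : ℕ
  coins : PMF (Fin coinLen → Bool)
  msg : X → (Fin coinLen → Bool) → List Bool
  out : Y → List Bool → Bool

namespace PrivateCoinProtocol

variable {X Y : Type*}

/-- The protocol computes `f` with error at most `1/3` on every input. -/
def Solves (P : PrivateCoinProtocol X Y) (f : X → Y → Bool) : Prop :=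
  ∀ x y, P.coins.toMeasure {R | P.out y (P.msg x R) ≠ f x y} ≤ 1 / 3

/-- Communication cost: the maximum length of Alice's message over all `(x, R)`. -/
def cost [Fintype X] (P : PrivateCoinProtocol X Y) : ℕ :=
  Finset.univ.sup fun xR : X × (Fin P.coinLen → Bool) => (P.msg xR.1 xR.2).length

/-- Every function on a finite domain is solved by some protocol, so that the infimum below is
a minimum over a non-empty set of natural numbers. -/
theorem exists_solves [Fintype X] (f : X → Y → Bool) :
    ∃ P : PrivateCoinProtocol X Y, P.Solves f := by
  classical
  refine ⟨{ coinLen := 0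
            coins := PMF.pure default
            msg := fun x _ => List.replicate (Fintype.equivFin X x : ℕ) true
            out := fun y m => if h : m.length < Fintype.card X then
              f ((Fintype.equivFin X).symm ⟨m.length, h⟩) y else false }, ?_⟩
  intro x y
  simp

end PrivateCoinProtocol

/-- One-way randomized (private-coin) communication complexity: the minimum cost of a private-coin
protocol that solves `f`. -/
noncomputable def oneWayComplexity {X Y : Type*} [Fintype X] (f : X → Y → Bool) : ℕ :=
  sInf {c | ∃ P : PrivateCoinProtocol X Y, P.Solves f ∧ P.cost = c}

/-- An online Merlin-Arthur protocol for inputs `x : X` (Alice) and `y : Y` (Bob). Merlin, who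
knows `x` and `y`, sends Bob a bit string; `help x y` is the string sent by the honest Merlin.
Then Alice draws a random string `R` of `coinLen` bits from the distribution `coins` and sends Bob
the bit string `msg x R`. Bob, holding `y`, Merlin's string, Alice's message and `R`, outputs
`some true` (for 1), `some false` (for 0) or `none` (for rejecting the proof). -/
structure OMAProtocol (X Y : Type*) where
  coinLen : ℕ
  coins : PMF (Fin coinLen → Bool)
  help : X → Y → List Bool
  msg : X → (Fin coinLen → Bool) → List Bool
  out : Y → List Bool → List Bool → (Fin coinLen → Bool) → Option Bool

namespace OMAProtocol

variable {X Y : Type*}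

/-- The protocol has completeness error and soundness error at most `1/3` for `f`. -/
def Solves (P : OMAProtocol X Y) (f : X → Y → Bool) : Prop :=
  (∀ x y, f x y = true →
    P.coins.toMeasure {R | P.out y (P.help x y) (P.msg x R) R ≠ some true} ≤ 1 / 3) ∧
  (∀ x y, f x y = false → ∀ H' : List Bool,
    P.coins.toMeasure {R | P.out y H' (P.msg x R) R = some true} ≤ 1 / 3)

/-- Help cost: the maximum length of Merlin's message over all `(x, y)`. -/
def hcost [Fintype X] [Fintype Y] (P : OMAProtocol X Y) : ℕ :=
  Finset.univ.sup fun xy : X × Y => (P.help xy.1 xy.2).length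

/-- Verification cost: the maximum length of Alice's message over all `(x, R)`. -/
def vcost [Fintype X] (P : OMAProtocol X Y) : ℕ :=
  Finset.univ.sup fun xR : X × (Fin P.coinLen → Bool) => (P.msg xR.1 xR.2).length

/-- Total cost. -/
def tcost [Fintype X] [Fintype Y] (P : OMAProtocol X Y) : ℕ :=
  P.hcost + P.vcost

end OMAProtocol

/-- A family of protocols `P i` for functions `f i` is non-trivial, along the filter `l` on the
index set, if the number of bits that Alice sends is of smaller order than the one-way randomized
communication complexity. -/
def NonTrivialFamily {ι : Type*} (l : Filter ι) {X Y : ι → Type*} [∀ i, Fintype (X i)]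
    (f : ∀ i, X i → Y i → Bool) (P : ∀ i, OMAProtocol (X i) (Y i)) : Prop :=
  (fun i => ((P i).vcost : ℝ)) =o[l] fun i => (oneWayComplexity (f i) : ℝ)

/-- The Equals-Index function: Alice holds `x 0, …, x (p - 1)` in `{0,1}^q`, Bob holds
`y ∈ {0,1}^q` and an index `j`, and the value is `1` iff `y = x j`. -/
def eqIdx (p q : ℕ) (x : Fin p → Fin q → Bool) (yj : (Fin q → Bool) × Fin p) : Bool :=
  decide (yj.1 = x yj.2)

/-! The core is the bound `p * q ≤ 720 * (vcost * (q + hcost))` for every OMA protocol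
(`OMAProtocol.mul_le_mul_vcost`). Run Alice's part `2n` times with `n` of order `q + hcost`.
Majority voting then makes the error so small that a union bound over all `2 ^ q` candidates `y` and
all help strings applies. A decoder can thus replace Merlin by exhaustive search and recover each
block of `x` with error at most `1/10`. As `x` has `p * q` bits, the `2n * vcost` bits sent must be
of order `p * q` (`card_messages_lower_bound`).

For the one-way complexity, blocks that are all zeros or all ones embed the index problem on `p`
bits, so the same counting lemma gives order `p` from below. From above, Alice sends a random seed
of `O(1 + log q)` bits and a three-bit fingerprint of each block. When `log q = O(p)` both bounds
are of order `p`, so non-triviality means `vcost = o(p)`. The core bound then forces `q = o(q +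
hcost)`, hence `q = o(hcost)`. -/

/-! ### Counting messages that determine most coordinates of the input -/

/-- The bit strings of length at most `n`. -/
def bitStrings (n : ℕ) : Finset (List Bool) :=
  (Finset.range (n + 1)).biUnion fun k =>
    (Finset.univ : Finset (Fin k → Bool)).image List.ofFn

theorem mem_bitStrings {n : ℕ} {s : List Bool} (h : s.length ≤ n) : s ∈ bitStrings n := by
  simp only [bitStrings, Finset.mem_biUnion, Finset.mem_range, Finset.mem_image,
    Finset.mem_univ, true_and]
  exact ⟨s.length, by omega, s.get, List.ofFn_get s⟩

/-- Messages have variable length, so the true count is `2 ^ (n + 1) - 1`. The bound `4 ^ n` costs a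
factor 2 in the exponent but is exact at `n = 0`, which keeps the later bounds free of additive
terms. -/
theorem card_bitStrings_le (n : ℕ) : (bitStrings n).card ≤ 4 ^ n := by
  have h1 : (bitStrings n).card ≤ ∑ k ∈ Finset.range (n + 1), 2 ^ k := by
    refine Finset.card_biUnion_le.trans (Finset.sum_le_sum fun k _ => ?_)
    refine Finset.card_image_le.trans ?_
    simp
  refine h1.trans ?_
  clear h1
  induction n with
  | zero => simp
  | succ n ih =>
    rw [Finset.sum_range_succ]
    have h2 : (2 : ℕ) ^ (n + 1) ≤ 3 * 4 ^ n := by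
      have : (2 : ℕ) ^ n ≤ 4 ^ n := Nat.pow_le_pow_left (by norm_num) n
      rw [pow_succ]
      omega
    rw [pow_succ 4]
    omega

/-- The weight is a product over coordinates: each contributes 1 for the agreeing letter and `exp
(-L)` for each other letter. -/
theorem sum_exp_neg_hammingDist {ι A : Type*} [Fintype ι] [DecidableEq ι] [Fintype A]
    [DecidableEq A] (L : ℝ) (z : ι → A) :
    ∑ x : ι → A, Real.exp (-L * hammingDist z x) =
      (1 + ((Fintype.card A : ℝ) - 1) * Real.exp (-L)) ^ Fintype.card ι := by
  have h1 : ∀ x : ι → A, Real.exp (-L * hammingDist z x) =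
      ∏ j, if z j ≠ x j then Real.exp (-L) else 1 := by
    intro x
    rw [Finset.prod_ite, Finset.prod_const, Finset.prod_const_one, mul_one, ← Real.exp_nat_mul,
      mul_comm]
    rfl
  have h2 : ∀ a : A, ∑ b : A, (if a ≠ b then Real.exp (-L) else 1) =
      1 + ((Fintype.card A : ℝ) - 1) * Real.exp (-L) := by
    intro a
    rw [← Finset.add_sum_erase _ _ (Finset.mem_univ a), if_neg (by simp),
      Finset.sum_congr rfl (g := fun _ => Real.exp (-L))
        (fun b hb => if_pos (Finset.ne_of_mem_erase hb).symm),
      Finset.sum_const, Finset.card_erase_of_mem (Finset.mem_univ a), Finset.card_univ,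
      nsmul_eq_mul, Nat.cast_sub (Fintype.card_pos_iff.2 ⟨a⟩), Nat.cast_one]
  simp_rw [h1]
  rw [← Fintype.piFinset_univ, ← Finset.prod_univ_sum (fun _ => Finset.univ)
    (fun j b => if z j ≠ b then Real.exp (-L) else 1)]
  simp_rw [h2]
  simp

/-- A random message from which each coordinate of `x : ι → A` is recovered with error at most `δ`
takes many values. -/
theorem card_messages_lower_bound {ι A Ω M : Type*} [Fintype ι] [Fintype A] [DecidableEq A]
    [DecidableEq ι] [Fintype Ω] (w : Ω → ℝ) (hw : ∀ r, 0 ≤ w r) (hw1 : ∑ r, w r = 1)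
    (S : Finset M) (msg : (ι → A) → Ω → M) (hmsg : ∀ x r, msg x r ∈ S)
    (dec : Ω → M → ι → A) (δ L : ℝ) (hL : 0 ≤ L)
    (herr : ∀ x j, (∑ r, if dec r (msg x r) j ≠ x j then w r else 0) ≤ δ) :
    (Fintype.card A : ℝ) ^ Fintype.card ι * Real.exp (-L * (δ * Fintype.card ι)) ≤
      S.card * (1 + ((Fintype.card A : ℝ) - 1) * Real.exp (-L)) ^ Fintype.card ι := by
  set D := δ * (Fintype.card ι : ℝ) with hD
  have hlow : ∀ x : ι → A, Real.exp (-L * D) ≤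
      ∑ r, w r * Real.exp (-L * hammingDist (dec r (msg x r)) x) := by
    intro x
    have hE : ∑ r, w r * (hammingDist (dec r (msg x r)) x : ℝ) ≤ D := by
      calc ∑ r, w r * (hammingDist (dec r (msg x r)) x : ℝ)
          = ∑ r, ∑ j, if dec r (msg x r) j ≠ x j then w r else 0 := by
            refine Finset.sum_congr rfl fun r _ => ?_
            rw [Finset.sum_ite, Finset.sum_const, Finset.sum_const_zero, add_zero,
              nsmul_eq_mul, mul_comm]
            rfl
        _ = ∑ j, ∑ r, if dec r (msg x r) j ≠ x j then w r else 0 := Finset.sum_comm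
        _ ≤ ∑ _j : ι, δ := Finset.sum_le_sum fun j _ => herr x j
        _ = D := by simp [hD, mul_comm]
    -- Tangent line of `exp (-L * d)` at `d = D`; averaging it is Jensen's inequality.
    have htan : ∀ d : ℝ, Real.exp (-L * D) * (1 - L * (d - D)) ≤ Real.exp (-L * d) := by
      intro d
      have h := Real.add_one_le_exp (-L * (d - D))
      have h' : Real.exp (-L * d) = Real.exp (-L * D) * Real.exp (-L * (d - D)) := by
        rw [← Real.exp_add]; ring_nf
      rw [h']
      exact mul_le_mul_of_nonneg_left (by linarith) (Real.exp_pos _).le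
    calc Real.exp (-L * D)
        ≤ Real.exp (-L * D) *
          (1 - L * (∑ r, w r * (hammingDist (dec r (msg x r)) x : ℝ) - D)) := by
          refine le_mul_of_one_le_right (Real.exp_pos _).le ?_
          nlinarith
      _ = ∑ r, w r * (Real.exp (-L * D) *
            (1 - L * ((hammingDist (dec r (msg x r)) x : ℝ) - D))) := by
          have : ∀ r, w r * (Real.exp (-L * D) *
            (1 - L * ((hammingDist (dec r (msg x r)) x : ℝ) - D))) =
            Real.exp (-L * D) * (1 + L * D) * w r -
              Real.exp (-L * D) * L * (w r * (hammingDist (dec r (msg x r)) x : ℝ)) := by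
            intro r; ring
          simp_rw [this]
          rw [Finset.sum_sub_distrib, ← Finset.mul_sum, ← Finset.mul_sum, hw1]
          ring
      _ ≤ _ := Finset.sum_le_sum fun r _ => mul_le_mul_of_nonneg_left (htan _) (hw r)
  -- For fixed coins the decoder has at most `S.card` outputs, even if it sees the coins as Bob does
  -- in an OMA protocol.
  have hup : ∀ r, ∑ x : ι → A, Real.exp (-L * hammingDist (dec r (msg x r)) x) ≤
      S.card * (1 + ((Fintype.card A : ℝ) - 1) * Real.exp (-L)) ^ Fintype.card ι := by
    intro r
    calc ∑ x : ι → A, Real.exp (-L * hammingDist (dec r (msg x r)) x)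
        ≤ ∑ x : ι → A, ∑ m ∈ S, Real.exp (-L * hammingDist (dec r m) x) :=
          Finset.sum_le_sum fun x _ => Finset.single_le_sum
            (f := fun m => Real.exp (-L * hammingDist (dec r m) x))
            (fun m _ => (Real.exp_pos _).le) (hmsg x r)
      _ = ∑ m ∈ S, ∑ x : ι → A, Real.exp (-L * hammingDist (dec r m) x) := Finset.sum_comm
      _ = _ := by
          rw [Finset.sum_congr rfl fun m _ => ?_, Finset.sum_const, nsmul_eq_mul]
          exact sum_exp_neg_hammingDist L (dec r m)
  calc (Fintype.card A : ℝ) ^ Fintype.card ι * Real.exp (-L * D)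
      = ∑ _x : ι → A, Real.exp (-L * D) := by simp
    _ ≤ ∑ x : ι → A, ∑ r, w r * Real.exp (-L * hammingDist (dec r (msg x r)) x) :=
        Finset.sum_le_sum fun x _ => hlow x
    _ = ∑ r, w r * ∑ x : ι → A, Real.exp (-L * hammingDist (dec r (msg x r)) x) := by
        rw [Finset.sum_comm]
        simp_rw [Finset.mul_sum]
    _ ≤ ∑ r, w r * (S.card *
          (1 + ((Fintype.card A : ℝ) - 1) * Real.exp (-L)) ^ Fintype.card ι) :=
        Finset.sum_le_sum fun r _ => mul_le_mul_of_nonneg_left (hup r) (hw r)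
    _ = _ := by rw [← Finset.sum_mul, hw1, one_mul]

/-! ### Amplification by majority vote -/

/-- Of `2n` independent trials, each failing with probability at most `1/3`, at least `n` fail with
probability at most `(8/9)^n`. -/
theorem sum_majority_le {Ω : Type*} [Fintype Ω] (w : Ω → ℝ) (hw : ∀ r, 0 ≤ w r)
    (hw1 : ∑ r, w r = 1) (bad : Ω → Prop) [DecidablePred bad]
    (hbad : (∑ r, if bad r then w r else 0) ≤ 1 / 3) (n : ℕ) :
    (∑ R : Fin (2 * n) → Ω,
      if n ≤ (Finset.univ.filter fun i => bad (R i)).card then ∏ i, w (R i) else 0) ≤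
      (8 / 9 : ℝ) ^ n := by
  set s := ∑ r, if bad r then w r else 0 with hs
  have hs0 : 0 ≤ s := Finset.sum_nonneg fun r _ => by split_ifs <;> simp [hw]
  -- Exponential Markov: the indicator of at least `n` failures is at most `2 ^ (failures - n)`,
  -- whose mean factors over the trials.
  have h1 : ∀ R : Fin (2 * n) → Ω,
      (if n ≤ (Finset.univ.filter fun i => bad (R i)).card then ∏ i, w (R i) else 0) ≤
      (1 / 2 : ℝ) ^ n * ∏ i, (w (R i) * if bad (R i) then 2 else 1) := by
    intro R
    have hp : 0 ≤ ∏ i, w (R i) := Finset.prod_nonneg fun i _ => hw _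
    rw [Finset.prod_mul_distrib, Finset.prod_ite, Finset.prod_const, Finset.prod_const_one, mul_one]
    split_ifs with h
    · have h2 : (2 : ℝ) ^ n ≤ 2 ^ (Finset.univ.filter fun i => bad (R i)).card :=
        pow_le_pow_right₀ (by norm_num) h
      calc ∏ i, w (R i) = (1 / 2 : ℝ) ^ n * ((∏ i, w (R i)) * 2 ^ n) := by
            rw [mul_left_comm, ← mul_pow]; norm_num
        _ ≤ _ := by gcongr
    · positivity
  have h2 : ∑ r, (w r * if bad r then 2 else 1) = ∑ r, w r + s := by
    rw [hs, ← Finset.sum_add_distrib]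
    refine Finset.sum_congr rfl fun r _ => ?_
    split_ifs <;> ring
  calc _ ≤ ∑ R : Fin (2 * n) → Ω,
        (1 / 2 : ℝ) ^ n * ∏ i, (w (R i) * if bad (R i) then 2 else 1) :=
        Finset.sum_le_sum fun R _ => h1 R
    _ = (1 / 2 : ℝ) ^ n * (1 + s) ^ (2 * n) := by
        rw [← Finset.mul_sum, ← Fintype.piFinset_univ,
          ← Finset.prod_univ_sum (fun _ => Finset.univ)
            (fun (_ : Fin (2 * n)) r => w r * if bad r then 2 else 1)]
        simp_rw [h2, hw1]
        simp
    _ ≤ (1 / 2 : ℝ) ^ n * (4 / 3) ^ (2 * n) := by gcongr; linarith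
    _ = _ := by rw [pow_mul, ← mul_pow]; norm_num

/-! ### Protocols as finite weighted sums -/

theorem PMF.sum_toReal_eq_one {α : Type*} [Fintype α] (μ : PMF α) :
    ∑ a, (μ a).toReal = 1 := by
  rw [← ENNReal.toReal_sum fun a _ => μ.apply_ne_top a, ← tsum_fintype (L := .unconditional α) (fun a => μ a), μ.tsum_coe,
    ENNReal.toReal_one]

theorem PMF.sum_ite_toReal_le {α : Type*} [Fintype α] [MeasurableSpace α]
    [DiscreteMeasurableSpace α] (μ : PMF α) (q : α → Prop) [DecidablePred q]
    (h : μ.toMeasure {a | q a} ≤ 1 / 3) : (∑ a, if q a then (μ a).toReal else 0) ≤ 1 / 3 := by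
  have h1 : (∑ a, if q a then (μ a).toReal else 0) = (μ.toMeasure {a | q a}).toReal := by
    rw [PMF.toMeasure_apply_fintype, ENNReal.toReal_sum]
    · refine Finset.sum_congr rfl fun a _ => ?_
      by_cases hq : q a <;> simp [hq]
    · intro a _
      by_cases hq : q a <;> simp [hq, μ.apply_ne_top a]
  rw [h1]
  refine (ENNReal.toReal_mono (by simp) h).trans ?_
  simp

theorem PrivateCoinProtocol.msg_mem_bitStrings {X Y : Type*} [Fintype X]
    (P : PrivateCoinProtocol X Y) (x : X) (R : Fin P.coinLen → Bool) :
    P.msg x R ∈ bitStrings P.cost :=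
  mem_bitStrings (Finset.le_sup (f := fun xR : X × (Fin P.coinLen → Bool) =>
    (P.msg xR.1 xR.2).length) (Finset.mem_univ (x, R)))

theorem OMAProtocol.msg_mem_bitStrings {X Y : Type*} [Fintype X]
    (P : OMAProtocol X Y) (x : X) (R : Fin P.coinLen → Bool) :
    P.msg x R ∈ bitStrings P.vcost :=
  mem_bitStrings (Finset.le_sup (f := fun xR : X × (Fin P.coinLen → Bool) =>
    (P.msg xR.1 xR.2).length) (Finset.mem_univ (x, R)))

theorem OMAProtocol.help_mem_bitStrings {X Y : Type*} [Fintype X] [Fintype Y]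
    (P : OMAProtocol X Y) (x : X) (y : Y) : P.help x y ∈ bitStrings P.hcost :=
  mem_bitStrings (Finset.le_sup (f := fun xy : X × Y => (P.help xy.1 xy.2).length)
    (Finset.mem_univ (x, y)))

/-! ### Lower bound for one-way protocols -/

theorem PrivateCoinProtocol.length_le_mul_cost {p q : ℕ} (hq : 0 < q)
    (P : PrivateCoinProtocol (Fin p → Fin q → Bool) ((Fin q → Bool) × Fin p))
    (hP : P.Solves (eqIdx p q)) : p ≤ 30 * P.cost := by
  -- Reduction from the index problem: block `j` repeats the bit `x j`, and Bob asks whether it is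
  -- the all-ones string.
  have key := card_messages_lower_bound (A := Bool) (ι := Fin p)
    (fun R => (P.coins R).toReal) (fun _ => ENNReal.toReal_nonneg) P.coins.sum_toReal_eq_one
    (bitStrings P.cost) (fun x R => P.msg (fun j _ => x j) R)
    (fun x R => P.msg_mem_bitStrings _ R)
    (fun _ m j => P.out (fun _ => true, j) m) (1 / 3) (Real.log 2) (Real.log_nonneg one_le_two)
    (by
      intro x j
      have h := hP (fun j _ => x j) (fun _ => true, j)
      have hval : eqIdx p q (fun j _ => x j) (fun _ => true, j) = x j := by
        have : ((fun _ : Fin q => true) = fun _ => x j) ↔ x j = true :=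
          ⟨fun h => (congrFun h ⟨0, hq⟩).symm, fun h => by rw [h]⟩
        simp [eqIdx, this]
      rw [hval] at h
      exact P.coins.sum_ite_toReal_le _ h)
  have hcard : ((bitStrings P.cost).card : ℝ) ≤ 4 ^ P.cost := by
    exact_mod_cast card_bitStrings_le P.cost
  rw [Real.exp_neg, Real.exp_log two_pos, Fintype.card_bool, Fintype.card_fin] at key
  norm_num at key
  have h1 : (2 : ℝ) ^ p * Real.exp (-(Real.log 2 * (1 / 3 * p))) ≤ 4 ^ P.cost * (3 / 2) ^ p :=
    key.trans (by gcongr)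
  -- Cubing clears the error rate `1/3` from the exponent.
  have h2 := pow_le_pow_left₀ (by positivity) h1 3
  have h3 : Real.exp (-(Real.log 2 * (1 / 3 * p))) ^ 3 = (1 / 2) ^ p := by
    rw [← Real.exp_nat_mul, show ((3 : ℕ) : ℝ) * -(Real.log 2 * (1 / 3 * p)) = p * (-Real.log 2) by
      push_cast; ring, Real.exp_nat_mul, Real.exp_neg, Real.exp_log two_pos, one_div]
  rw [mul_pow, mul_pow, h3, ← pow_mul, ← pow_mul, ← pow_mul, mul_comm p 3, pow_mul, ← mul_pow,
    mul_comm P.cost 3, pow_mul 4, pow_mul (3 / 2 : ℝ)] at h2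
  norm_num at h2
  have h4 : (32 / 27 : ℝ) ^ p ≤ 64 ^ P.cost := by
    have : (32 / 27 : ℝ) ^ p * (27 / 8) ^ p = 4 ^ p := by rw [← mul_pow]; norm_num
    rw [← this] at h2
    exact le_of_mul_le_mul_right h2 (by positivity)
  -- Since `(32/27)^5 ≥ 2` and `64 ^ 5 = 2 ^ 30`, the constant is 30.
  have h5 : (2 : ℝ) ^ p ≤ 2 ^ (30 * P.cost) := by
    calc (2 : ℝ) ^ p ≤ ((32 / 27) ^ 5) ^ p := by gcongr; norm_num
      _ = ((32 / 27 : ℝ) ^ p) ^ 5 := by rw [← pow_mul, ← pow_mul, mul_comm]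
      _ ≤ (64 ^ P.cost) ^ 5 := by gcongr
      _ = _ := by
        rw [show (64 : ℝ) = 2 ^ 6 by norm_num, ← pow_mul, ← pow_mul]
        congr 1; ring
  exact (pow_le_pow_iff_right₀ one_lt_two).1 h5

theorem le_mul_oneWayComplexity_eqIdx {p q : ℕ} (hq : 0 < q) :
    p ≤ 30 * oneWayComplexity (eqIdx p q) := by
  obtain ⟨P, hP⟩ := PrivateCoinProtocol.exists_solves (eqIdx p q)
  obtain ⟨P', hP', hc⟩ := Nat.sInf_mem
    (s := {c | ∃ P : PrivateCoinProtocol _ _, P.Solves (eqIdx p q) ∧ P.cost = c}) ⟨_, P, hP, rfl⟩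
  have := P'.length_le_mul_cost hq hP'
  rwa [hc] at this

/-! ### Trade-off between help and verification in OMA protocols -/

/-- Majority vote over `2n` independent runs, combined with a search over all of Merlin's strings,
recovers each block of Alice's input from her messages. -/
theorem OMAProtocol.exists_decoder {p q : ℕ}
    (P : OMAProtocol (Fin p → Fin q → Bool) ((Fin q → Bool) × Fin p))
    (hP : P.Solves (eqIdx p q)) (n : ℕ) :
    ∃ dec : (Fin (2 * n) → Fin P.coinLen → Bool) → (Fin (2 * n) → List Bool) →
        Fin p → Fin q → Bool,
      ∀ x j, (∑ R : Fin (2 * n) → Fin P.coinLen → Bool,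
        if dec R (fun i => P.msg x (R i)) j ≠ x j then ∏ i, (P.coins (R i)).toReal else 0) ≤
        (1 + 2 ^ q * 4 ^ P.hcost) * (8 / 9 : ℝ) ^ n := by
  classical
  let acc : (Fin (2 * n) → Fin P.coinLen → Bool) → (Fin (2 * n) → List Bool) → Fin p →
      (Fin q → Bool) → List Bool → Finset (Fin (2 * n)) := fun R m j y H =>
    Finset.univ.filter fun i => P.out (y, j) H (m i) (R i) = some true
  let dec : (Fin (2 * n) → Fin P.coinLen → Bool) → (Fin (2 * n) → List Bool) →
      Fin p → Fin q → Bool := fun R m j =>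
    -- Any candidate with a strict majority for some short help string will do: the true block
    -- usually has one, and wrong blocks rarely do.
    if h : ∃ y, ∃ H ∈ bitStrings P.hcost, n < (acc R m j y H).card then h.choose
    else fun _ => false
  refine ⟨dec, fun x j => ?_⟩
  set w : (Fin P.coinLen → Bool) → ℝ := fun R => (P.coins R).toReal with hw
  have hw0 : ∀ r, 0 ≤ w r := fun _ => ENNReal.toReal_nonneg
  have hw1 : ∑ r, w r = 1 := P.coins.sum_toReal_eq_one
  let W : (Fin (2 * n) → Fin P.coinLen → Bool) → ℝ := fun R => ∏ i, w (R i)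
  have hW0 : ∀ R, 0 ≤ W R := fun R => Finset.prod_nonneg fun i _ => hw0 _
  let rej : (Fin P.coinLen → Bool) → Prop := fun R =>
    P.out (x j, j) (P.help x (x j, j)) (P.msg x R) R ≠ some true
  let fool : (Fin q → Bool) → List Bool → (Fin P.coinLen → Bool) → Prop := fun y H R =>
    P.out (y, j) H (P.msg x R) R = some true
  have hrej := sum_majority_le w hw0 hw1 rej
    (P.coins.sum_ite_toReal_le _ (hP.1 x (x j, j) (by simp [eqIdx]))) n
  have hfool : ∀ y, y ≠ x j → ∀ H, _ := fun y hy H => sum_majority_le w hw0 hw1 (fool y H)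
    (P.coins.sum_ite_toReal_le _ (hP.2 x (y, j) (by simp [eqIdx, hy]) H)) n
  let Bad : (Fin q → Bool) × List Bool → (Fin (2 * n) → Fin P.coinLen → Bool) → Prop :=
    fun yH R => yH.1 ≠ x j ∧ n ≤ (Finset.univ.filter fun i => fool yH.1 yH.2 (R i)).card
  let T : Finset ((Fin q → Bool) × List Bool) := Finset.univ ×ˢ bitStrings P.hcost
  -- A decoding failure means that the honest help is rejected at least `n` times, or that some
  -- wrong block with some help string is accepted at least `n` times.
  have hpt : ∀ R, (if dec R (fun i => P.msg x (R i)) j ≠ x j then W R else 0) ≤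
      (if n ≤ (Finset.univ.filter fun i => rej (R i)).card then W R else 0) +
        ∑ yH ∈ T, if Bad yH R then W R else 0 := by
    intro R
    have hsum : 0 ≤ ∑ yH ∈ T, if Bad yH R then W R else 0 :=
      Finset.sum_nonneg fun _ _ => by split_ifs <;> simp [hW0]
    by_cases hr : n ≤ (Finset.univ.filter fun i => rej (R i)).card
    · rw [if_pos hr]
      split_ifs
      · linarith
      · linarith [hW0 R]
    rw [if_neg hr, zero_add]
    split_ifs with hd
    swap
    · exact hsum
    have hex : ∃ y, ∃ H ∈ bitStrings P.hcost,
        n < (acc R (fun i => P.msg x (R i)) j y H).card := by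
      refine ⟨x j, P.help x (x j, j), P.help_mem_bitStrings _ _, ?_⟩
      have := Finset.card_filter_add_card_filter_not (s := (Finset.univ : Finset (Fin (2 * n))))
        (fun i => P.out (x j, j) (P.help x (x j, j)) (P.msg x (R i)) (R i) = some true)
      rw [Finset.card_univ, Fintype.card_fin] at this
      change ¬ n ≤ (Finset.univ.filter fun i =>
        ¬ P.out (x j, j) (P.help x (x j, j)) (P.msg x (R i)) (R i) = some true).card at hr
      change n < (Finset.univ.filter fun i =>
        P.out (x j, j) (P.help x (x j, j)) (P.msg x (R i)) (R i) = some true).card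
      omega
    have hdec : dec R (fun i => P.msg x (R i)) j = hex.choose := dif_pos hex
    obtain ⟨H, hH, hcard⟩ := hex.choose_spec
    rw [hdec] at hd
    have hB : Bad (hex.choose, H) R := ⟨hd, hcard.le⟩
    have := Finset.single_le_sum (s := T) (f := fun yH => if Bad yH R then W R else 0)
      (fun _ _ => by split_ifs <;> simp [hW0])
      (show (hex.choose, H) ∈ T from Finset.mem_product.2 ⟨Finset.mem_univ _, hH⟩)
    simpa only [if_pos hB] using this
  have hcard : ((bitStrings P.hcost).card : ℝ) ≤ 4 ^ P.hcost := by
    exact_mod_cast card_bitStrings_le P.hcost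
  calc _ ≤ ∑ R, ((if n ≤ (Finset.univ.filter fun i => rej (R i)).card then W R else 0) +
        ∑ yH ∈ T, if Bad yH R then W R else 0) := Finset.sum_le_sum fun R _ => hpt R
    _ = (∑ R, if n ≤ (Finset.univ.filter fun i => rej (R i)).card then W R else 0) +
        ∑ yH ∈ T, ∑ R, if Bad yH R then W R else 0 := by
        rw [Finset.sum_add_distrib, Finset.sum_comm (t := T)]
    _ ≤ (8 / 9 : ℝ) ^ n + ∑ yH ∈ T, (8 / 9 : ℝ) ^ n := by
        refine add_le_add hrej (Finset.sum_le_sum fun yH _ => ?_)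
        by_cases hy : yH.1 = x j
        · simp only [Bad, hy, ne_eq, not_true_eq_false, false_and, if_false,
            Finset.sum_const_zero]
          positivity
        · simp only [Bad, ne_eq, hy, not_false_eq_true, true_and]
          exact hfool yH.1 hy yH.2
    _ = (1 + 2 ^ q * (bitStrings P.hcost).card) * (8 / 9 : ℝ) ^ n := by
        simp [T, Finset.card_product, add_mul]
    _ ≤ _ := by gcongr

/-- Since `(8/9)^6 < 1/2`, each group of six halves the error: `a + 2 * b` groups pay for the union
bound, and five more leave `2 / 32`. -/
theorem one_add_mul_pow_le (a b : ℕ) :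
    (1 + 2 ^ a * 4 ^ b) * (8 / 9 : ℝ) ^ (6 * (a + 2 * b + 5)) ≤ 1 / 10 := by
  have h1 : (8 / 9 : ℝ) ^ (6 * (a + 2 * b + 5)) ≤ (1 / 2) ^ (a + 2 * b + 5) := by
    rw [pow_mul]; gcongr; norm_num
  have h2 : (1 + 2 ^ a * 4 ^ b : ℝ) ≤ 2 * 2 ^ (a + 2 * b) := by
    have h3 : (2 : ℝ) ^ (a + 2 * b) = 2 ^ a * 4 ^ b := by rw [pow_add, pow_mul]; norm_num
    have h4 : (1 : ℝ) ≤ 2 ^ (a + 2 * b) := one_le_pow₀ one_le_two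
    rw [← h3]; linarith
  calc _ ≤ 2 * 2 ^ (a + 2 * b) * (1 / 2 : ℝ) ^ (a + 2 * b + 5) := by gcongr
    _ = 2 * (2 ^ (a + 2 * b) * (1 / 2 : ℝ) ^ (a + 2 * b)) * (1 / 2) ^ 5 := by
        rw [pow_add (1 / 2 : ℝ)]; ring
    _ ≤ _ := by rw [← mul_pow]; norm_num

theorem OMAProtocol.mul_le_mul_vcost {p q : ℕ} (hq : 0 < q)
    (P : OMAProtocol (Fin p → Fin q → Bool) ((Fin q → Bool) × Fin p))
    (hP : P.Solves (eqIdx p q)) : p * q ≤ 720 * (P.vcost * (q + P.hcost)) := by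
  classical
  set n := 6 * (q + 2 * P.hcost + 5) with hn
  obtain ⟨dec, hdec⟩ := P.exists_decoder hP n
  have hw0 : ∀ r, 0 ≤ (P.coins r).toReal := fun _ => ENNReal.toReal_nonneg
  -- With `exp (-L) = 2 ^ (-(q + 1))` all wrong letters together weigh less than `1/2`, while error
  -- rate `1/10` costs only `(q + 1) / 10` bits per block.
  have key := card_messages_lower_bound (A := Fin q → Bool) (ι := Fin p)
    (fun R : Fin (2 * n) → Fin P.coinLen → Bool => ∏ i, (P.coins (R i)).toReal)
    (fun R => Finset.prod_nonneg fun i _ => hw0 _)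
    (by
      rw [← Fintype.piFinset_univ, ← Finset.prod_univ_sum (fun _ => Finset.univ)
        (fun (_ : Fin (2 * n)) r => (P.coins r).toReal)]
      simp [P.coins.sum_toReal_eq_one])
    (Fintype.piFinset fun _ => bitStrings P.vcost) (fun x R i => P.msg x (R i))
    (fun x R => Fintype.mem_piFinset.2 fun i => P.msg_mem_bitStrings x (R i))
    dec (1 / 10) (Real.log (2 ^ (q + 1))) (Real.log_nonneg (one_le_pow₀ one_le_two))
    (fun x j => (hdec x j).trans (one_add_mul_pow_le q P.hcost))
  have hcard : ((Fintype.piFinset fun _ : Fin (2 * n) => bitStrings P.vcost).card : ℝ) ≤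
      (4 ^ P.vcost) ^ (2 * n) := by
    rw [Fintype.card_piFinset_const]
    exact_mod_cast Nat.pow_le_pow_left (card_bitStrings_le P.vcost) _
  have hfac : (1 + (((2 : ℝ) ^ q) - 1) * Real.exp (-Real.log (2 ^ (q + 1)))) ≤ 3 / 2 := by
    rw [Real.exp_neg, Real.exp_log (by positivity), pow_succ]
    have : (0 : ℝ) < 2 ^ q := by positivity
    rw [show (((2 : ℝ) ^ q) - 1) * (2 ^ q * 2)⁻¹ = 1 / 2 - (2 ^ q * 2)⁻¹ by field_simp]
    have : (0 : ℝ) < (2 ^ q * 2)⁻¹ := by positivity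
    linarith
  have hfac0 : 0 ≤ (1 + (((2 : ℝ) ^ q) - 1) * Real.exp (-Real.log (2 ^ (q + 1)))) := by
    have : (1 : ℝ) ≤ 2 ^ q := one_le_pow₀ one_le_two
    have := Real.exp_pos (-Real.log (2 ^ (q + 1)))
    nlinarith
  have hA : (Fintype.card (Fin q → Bool) : ℝ) = 2 ^ q := by simp
  rw [hA, Fintype.card_fin] at key
  have h1 := key.trans (mul_le_mul hcard (pow_le_pow_left₀ hfac0 hfac p) (by positivity)
    (by positivity))
  have h2 := pow_le_pow_left₀ (by positivity) h1 10
  have h3 : Real.exp (-Real.log (2 ^ (q + 1)) * (1 / 10 * p)) ^ 10 = ((2 ^ (q + 1)) ^ p)⁻¹ := by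
    rw [← Real.exp_nat_mul, show ((10 : ℕ) : ℝ) * (-Real.log (2 ^ (q + 1)) * (1 / 10 * p)) =
      p * (-Real.log (2 ^ (q + 1))) by push_cast; ring, Real.exp_nat_mul, Real.exp_neg,
      Real.exp_log (by positivity), inv_pow]
  rw [mul_pow, mul_pow, h3, ← div_eq_mul_inv, div_le_iff₀ (by positivity)] at h2
  have h4 : (2 : ℝ) ^ (q * p * 10) ≤
      2 ^ (2 * P.vcost * (2 * n) * 10 + 6 * p + (q + 1) * p) := by
    calc (2 : ℝ) ^ (q * p * 10) = ((2 ^ q) ^ p) ^ 10 := by rw [pow_mul, pow_mul]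
      _ ≤ _ := h2
      _ ≤ (((2 ^ 2) ^ P.vcost) ^ (2 * n)) ^ 10 * (2 ^ 6) ^ p * (2 ^ (q + 1)) ^ p := by
          rw [← pow_mul (3 / 2 : ℝ), mul_comm p 10, pow_mul (3 / 2 : ℝ)]
          gcongr <;> norm_num
      _ = _ := by simp only [← pow_mul, ← pow_add]
  -- The exponents give `10pq ≤ 40 * vcost * n + 7p + pq`; by `p ≤ pq` this leaves `pq ≤ 20 * vcost
  -- * n`, and `20 * 36 = 720`.
  have h5 := (pow_le_pow_iff_right₀ (one_lt_two (α := ℝ))).1 h4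
  have h6 : n ≤ 36 * (q + P.hcost) := by omega
  have h7 : P.vcost * n ≤ P.vcost * (36 * (q + P.hcost)) := Nat.mul_le_mul_left _ h6
  have h8 : p ≤ p * q := Nat.le_mul_of_pos_right p hq
  nlinarith

/-! ### Upper bound by fingerprinting -/

/-- Alice draws a uniform seed and sends an element of a set of at most `2 ^ L` messages. -/
theorem oneWayComplexity_le_of_seeds {X Y S M : Type*} [Fintype X] [Fintype S] [Nonempty S]
    [Fintype M] [Nonempty M] (f : X → Y → Bool) (L : ℕ) (hL : Fintype.card M ≤ 2 ^ L)
    (msg : X → S → M) (out : Y → M → Bool)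
    (herr : ∀ x y, 3 * Nat.card {s // out y (msg x s) ≠ f x y} ≤ Fintype.card S) :
    oneWayComplexity f ≤ L := by
  classical
  obtain ⟨e⟩ : Nonempty (M ↪ (Fin L → Bool)) :=
    Function.Embedding.nonempty_of_card_le (by simpa using hL)
  -- The coin distribution is arbitrary, so a uniform seed is pushed forward into bit strings even
  -- when `Fintype.card S` is not a power of two.
  obtain ⟨g⟩ : Nonempty (S ↪ (Fin (Fintype.card S) → Bool)) :=
    Function.Embedding.nonempty_of_card_le (by simpa using Nat.lt_two_pow_self.le)
  have henc : Function.Injective fun m => List.ofFn (e m) :=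
    List.ofFn_injective.comp e.injective
  let P : PrivateCoinProtocol X Y :=
    { coinLen := Fintype.card S
      coins := (PMF.uniformOfFintype S).map g
      msg := fun x R => List.ofFn (e (msg x (Function.invFun g R)))
      out := fun y m => out y (Function.invFun (fun m => List.ofFn (e m)) m) }
  have hP : P.Solves f := by
    intro x y
    let _ : MeasurableSpace S := ⊤
    have hset : g ⁻¹' {R | P.out y (P.msg x R) ≠ f x y} = {s | out y (msg x s) ≠ f x y} := by
      ext s
      have h1 : Function.invFun g (g s) = s := Function.leftInverse_invFun g.injective s
      have h2 := Function.leftInverse_invFun henc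
      simp only [P, Set.mem_preimage, Set.mem_ofPred_eq, h1]
      rw [h2 (msg x s)]
    change ((PMF.uniformOfFintype S).map g).toMeasure {R | P.out y (P.msg x R) ≠ f x y} ≤ 1 / 3
    rw [PMF.toMeasure_map_apply _ _ _ (measurable_from_top) (.of_discrete), hset,
      PMF.toMeasure_uniformOfFintype_apply _ (.of_discrete), ← Nat.card_eq_fintype_card]
    have h := herr x y
    have hpos : (0 : ℕ) < Fintype.card S := Fintype.card_pos
    rw [ENNReal.div_le_iff (by exact_mod_cast hpos.ne') (ENNReal.natCast_ne_top _), one_div,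
      ← ENNReal.div_eq_inv_mul, ENNReal.le_div_iff_mul_le (by simp) (by simp), mul_comm]
    exact_mod_cast h
  refine (Nat.sInf_le
    (s := {c | ∃ P : PrivateCoinProtocol X Y, P.Solves f ∧ P.cost = c}) ⟨P, hP, rfl⟩).trans (Finset.sup_le fun xR _ => ?_)
  simp [P]

/-- The polynomial over `R` with the bits of `x` as coefficients. -/
noncomputable def bitPolynomial (R : Type*) [Semiring R] {q : ℕ} (x : Fin q → Bool) :
    Polynomial R :=
  ∑ i : Fin q, Polynomial.monomial (i : ℕ) (if x i then 1 else 0)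

theorem coeff_bitPolynomial (R : Type*) [Semiring R] {q : ℕ} (x : Fin q → Bool) (i : Fin q) :
    (bitPolynomial R x).coeff i = if x i then 1 else 0 := by
  simp [bitPolynomial, Polynomial.finsetSum_coeff, Polynomial.coeff_monomial, Fin.val_inj]

theorem degree_bitPolynomial_lt (R : Type*) [Semiring R] {q : ℕ} (x : Fin q → Bool) :
    (bitPolynomial R x).degree < q :=
  (Polynomial.degree_sum_le _ _).trans_lt <| (Finset.sup_lt_iff (by exact WithBot.bot_lt_coe q)).2
    fun i _ => (Polynomial.degree_monomial_le _ _).trans_lt (by exact_mod_cast i.2)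

theorem card_eval_bitPolynomial_eq_le (F : Type*) [Field F] [Fintype F] [DecidableEq F] {q : ℕ}
    {x y : Fin q → Bool} (h : x ≠ y) :
    (Finset.univ.filter fun a : F =>
      (bitPolynomial F x).eval a = (bitPolynomial F y).eval a).card ≤ q := by
  set f := bitPolynomial F x - bitPolynomial F y with hf
  have hf0 : f ≠ 0 := by
    intro h0
    refine h (funext fun i => ?_)
    have := congrArg (fun g => g.coeff (i : ℕ)) h0
    simp only [hf, Polynomial.coeff_sub, coeff_bitPolynomial, Polynomial.coeff_zero] at this
    cases hx : x i <;> cases hy : y i <;> simp_all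
  have hdeg : f.degree < q := (Polynomial.degree_sub_le _ _).trans_lt
    (max_lt (degree_bitPolynomial_lt F x) (degree_bitPolynomial_lt F y))
  calc _ ≤ f.roots.toFinset.card := by
        refine Finset.card_le_card fun a ha => ?_
        simp only [Finset.mem_filter, Finset.mem_univ, true_and] at ha
        rw [Multiset.mem_toFinset, Polynomial.mem_roots hf0, Polynomial.IsRoot, hf,
          Polynomial.eval_sub, ha, sub_self]
    _ ≤ Multiset.card f.roots := Multiset.toFinset_card_le _
    _ ≤ f.natDegree := Polynomial.card_roots' f
    _ ≤ q := (Polynomial.natDegree_lt_iff_degree_lt hf0 |>.2 hdeg).le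

/-- A three-bit fingerprint of `x` with seed `s = (a, b, c)`. -/
noncomputable def fingerprint (P : ℕ) {q : ℕ} (s : ZMod P × ZMod P × ZMod P) (x : Fin q → Bool) :
    Fin 8 :=
  Fin.ofNat 8 (s.2.1 * (bitPolynomial (ZMod P) x).eval s.1 + s.2.2).val

/-- As `u ≠ v`, the values `t.1 * u + t.2` and `t.1 * v + t.2` determine `t`. In a collision the
first value fixes the second modulo 8, so only the quotient of the second by 8 is free. -/
theorem card_affine_collision_le (P : ℕ) [Fact P.Prime] {u v : ZMod P} (h : u ≠ v) :
    (Finset.univ.filter fun t : ZMod P × ZMod P =>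
      (t.1 * u + t.2).val % 8 = (t.1 * v + t.2).val % 8).card ≤ P * (P / 8 + 1) := by
  calc _ ≤ ((Finset.univ : Finset (ZMod P)) ×ˢ Finset.range (P / 8 + 1)).card := by
        refine Finset.card_le_card_of_injOn
          (fun t => (t.1 * u + t.2, (t.1 * v + t.2).val / 8)) ?_ ?_
        · intro t _
          simp only [Finset.coe_product, Finset.coe_univ, Finset.coe_range, Set.mem_prod,
            Set.mem_univ, Set.mem_Iio, true_and]
          have := ZMod.val_lt (t.1 * v + t.2)
          omega
        · rintro ⟨b, c⟩ ht ⟨b', c'⟩ ht' he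
          simp only [Finset.coe_filter, Finset.mem_univ, true_and, Set.mem_ofPred_eq] at ht ht'
          simp only [Prod.mk.injEq] at he
          obtain ⟨h1, h2⟩ := he
          rw [h1] at ht
          have h3 : b * v + c = b' * v + c' := ZMod.val_injective P (by omega)
          have h4 : (b - b') * (u - v) = 0 := by linear_combination h1 - h3
          have h5 : b = b' := by
            rcases mul_eq_zero.1 h4 with h | h'
            · exact sub_eq_zero.1 h
            · exact absurd (sub_eq_zero.1 h') h
          subst h5
          simpa using h1
    _ = _ := by simp [ZMod.card]

/-- Either the polynomials agree at the evaluation point, for at most `q` of `P` points, or the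
affine hash modulo 8 collides. The probabilities are below `1/12` and at most `1/8 + 1/P`, in total
less than `1/3`. -/
theorem card_fingerprint_collision_le (P : ℕ) [Fact P.Prime] {q : ℕ} (hP : 12 * q < P) (hq : 0 < q)
    {x y : Fin q → Bool} (h : x ≠ y) :
    3 * (Finset.univ.filter fun s : ZMod P × ZMod P × ZMod P =>
      fingerprint P s x = fingerprint P s y).card ≤ P ^ 3 := by
  classical
  set A := Finset.univ.filter fun a : ZMod P =>
    (bitPolynomial (ZMod P) x).eval a = (bitPolynomial (ZMod P) y).eval a
  have hA : A.card ≤ q := card_eval_bitPolynomial_eq_le (ZMod P) h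
  let B : ZMod P → Finset (ZMod P × ZMod P) := fun a => Finset.univ.filter fun t =>
    (t.1 * (bitPolynomial (ZMod P) x).eval a + t.2).val % 8 =
      (t.1 * (bitPolynomial (ZMod P) y).eval a + t.2).val % 8
  have hsub : (Finset.univ.filter fun s : ZMod P × ZMod P × ZMod P =>
      fingerprint P s x = fingerprint P s y) ⊆
      A ×ˢ Finset.univ ∪ Aᶜ.biUnion fun a => {a} ×ˢ B a := by
    rintro ⟨a, t⟩ hs
    simp only [Finset.mem_filter, Finset.mem_univ, true_and, fingerprint, Fin.ext_iff,
      Fin.ofNat] at hs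
    by_cases ha : a ∈ A
    · exact Finset.mem_union_left _ (Finset.mem_product.2 ⟨ha, Finset.mem_univ _⟩)
    · refine Finset.mem_union_right _ (Finset.mem_biUnion.2 ⟨a, Finset.mem_compl.2 ha, ?_⟩)
      exact Finset.mem_product.2 ⟨Finset.mem_singleton_self a,
        Finset.mem_filter.2 ⟨Finset.mem_univ _, hs⟩⟩
  have hB : ∀ a ∈ Aᶜ, ({a} ×ˢ B a : Finset _).card ≤ P * (P / 8 + 1) := by
    intro a ha
    rw [Finset.card_product, Finset.card_singleton, one_mul]
    refine card_affine_collision_le P fun he => Finset.mem_compl.1 ha ?_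
    exact Finset.mem_filter.2 ⟨Finset.mem_univ _, he⟩
  have h1 : (Finset.univ.filter fun s : ZMod P × ZMod P × ZMod P =>
      fingerprint P s x = fingerprint P s y).card ≤ q * (P * P) + P * (P * (P / 8 + 1)) := by
    refine (Finset.card_le_card hsub).trans ((Finset.card_union_le _ _).trans ?_)
    refine add_le_add ?_ ((Finset.card_biUnion_le_card_mul _ _ _ hB).trans ?_)
    · rw [Finset.card_product, Finset.card_univ, Fintype.card_prod, ZMod.card]
      exact Nat.mul_le_mul_right _ hA
    · exact Nat.mul_le_mul_right _ ((Finset.card_le_univ _).trans (ZMod.card P).le)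
  have h2 : 3 * (q + (P / 8 + 1)) ≤ P := by omega
  calc _ ≤ 3 * (q * (P * P) + P * (P * (P / 8 + 1))) := Nat.mul_le_mul_left _ h1
    _ = (3 * (q + (P / 8 + 1))) * (P * P) := by ring
    _ ≤ P * (P * P) := Nat.mul_le_mul_right _ h2
    _ = _ := by ring

theorem oneWayComplexity_eqIdx_le {p q : ℕ} (hq : 0 < q) :
    oneWayComplexity (eqIdx p q) ≤ 3 * (Nat.log 2 q + 6) + 3 * p := by
  classical
  obtain ⟨P, hprime, hlt, hle⟩ := Nat.exists_prime_lt_and_le_two_mul (12 * q) (by omega)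
  have : Fact P.Prime := ⟨hprime⟩
  refine oneWayComplexity_le_of_seeds (S := ZMod P × ZMod P × ZMod P)
    (M := (ZMod P × ZMod P × ZMod P) × (Fin p → Fin 8)) _ _ ?_
    (fun x s => (s, fun j => fingerprint P s (x j)))
    (fun yj m => decide (fingerprint P m.1 yj.1 = m.2 yj.2)) ?_
  · have h1 : P ≤ 2 ^ (Nat.log 2 q + 6) := by
      have := Nat.lt_pow_succ_log_self one_lt_two q
      rw [pow_succ] at this
      rw [pow_add]
      omega
    simp only [Fintype.card_prod, ZMod.card, Fintype.card_pi, Fintype.card_fin, Finset.prod_const,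
      Finset.card_univ]
    calc P * (P * P) * 8 ^ p = P ^ 3 * (2 ^ 3) ^ p := by ring
      _ ≤ (2 ^ (Nat.log 2 q + 6)) ^ 3 * (2 ^ 3) ^ p := by gcongr
      _ = _ := by rw [← pow_mul, ← pow_mul, ← pow_add, mul_comm _ 3]
  · rintro x ⟨y, j⟩
    rw [Nat.card_eq_fintype_card, Fintype.card_subtype]
    -- The error is one-sided: equal strings always have equal fingerprints.
    by_cases hy : y = x j
    · simp [eqIdx, hy]
    · have := card_fingerprint_collision_le P hlt hq hy
      simp only [eqIdx, hy, decide_false, ne_eq, decide_eq_false_iff_not, not_not]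
      simp only [Fintype.card_prod, ZMod.card]
      calc _ ≤ P ^ 3 := this
        _ = _ := by ring

/-! ### Asymptotics -/

theorem theorem1 {ι : Type*} (l : Filter ι) (p q : ι → ℕ)
    (hp : ∀ i, 0 < p i) (hq : ∀ i, 0 < q i)
    (hpq : (fun i => Real.logb 2 (q i : ℝ)) =O[l] fun i => (p i : ℝ)) :
    ((fun i => (oneWayComplexity (eqIdx (p i) (q i)) : ℝ)) =Θ[l]
      fun i => (p i : ℝ) + Real.logb 2 (q i : ℝ)) ∧
    ∀ P : ∀ i, OMAProtocol (Fin (p i) → Fin (q i) → Bool) ((Fin (q i) → Bool) × Fin (p i)),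
      (∀ i, (P i).Solves (eqIdx (p i) (q i))) →
      NonTrivialFamily l (fun i => eqIdx (p i) (q i)) P →
      (fun i => (q i : ℝ)) =o[l] fun i => ((P i).tcost : ℝ) := by
  have hlog0 : ∀ i, 0 ≤ Real.logb 2 (q i : ℝ) := fun i =>
    Real.logb_nonneg one_lt_two (by exact_mod_cast hq i)
  have hup : (fun i => (oneWayComplexity (eqIdx (p i) (q i)) : ℝ)) =O[l]
      fun i => (p i : ℝ) + Real.logb 2 (q i : ℝ) := by
    refine IsBigO.of_bound 21 (Eventually.of_forall fun i => ?_)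
    have h1 : (oneWayComplexity (eqIdx (p i) (q i)) : ℝ) ≤
        3 * ((Nat.log 2 (q i) : ℝ) + 6) + 3 * p i := by
      exact_mod_cast oneWayComplexity_eqIdx_le (hq i)
    have h2 : (Nat.log 2 (q i) : ℝ) ≤ Real.logb 2 (q i) := by
      exact_mod_cast Real.natLog_le_logb (q i) 2
    have h3 : (1 : ℝ) ≤ p i := by exact_mod_cast hp i
    have h4 := hlog0 i
    rw [Real.norm_of_nonneg (Nat.cast_nonneg _), Real.norm_of_nonneg (by positivity)]
    linarith
  have hpO : (fun i => (p i : ℝ) + Real.logb 2 (q i : ℝ)) =O[l] fun i => (p i : ℝ) :=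
    (isBigO_refl _ _).add hpq
  refine ⟨⟨hup, hpO.trans (IsBigO.of_bound 30 (Eventually.of_forall fun i => ?_))⟩, ?_⟩
  · have h1 : (p i : ℝ) ≤ 30 * oneWayComplexity (eqIdx (p i) (q i)) := by
      exact_mod_cast le_mul_oneWayComplexity_eqIdx (hq i)
    simpa using h1
  intro P hP hnt
  have hv : (fun i => ((P i).vcost : ℝ)) =o[l] fun i => (p i : ℝ) :=
    hnt.trans_isBigO (hup.trans hpO)
  refine IsLittleO.of_bound fun c hc => ?_
  -- Here `1440 = 2 * 720`, giving `q ≤ (min c 1 / 2) * (q + hcost)`; the cap at 1 lets half of `q`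
  -- be absorbed on the left, so that `q ≤ c * hcost`.
  have hε : 0 < min c 1 / 1440 := by positivity
  filter_upwards [hv.def hε] with i hi
  simp only [Real.norm_natCast] at hi ⊢
  have h1 : (p i : ℝ) * q i ≤ 720 * ((P i).vcost * (q i + (P i).hcost)) := by
    exact_mod_cast (P i).mul_le_mul_vcost (hq i) (hP i)
  have hp0 : (0 : ℝ) < p i := by exact_mod_cast hp i
  have h2 : (p i : ℝ) * q i ≤ p i * (min c 1 / 2 * (q i + (P i).hcost)) := by
    calc (p i : ℝ) * q i ≤ 720 * ((P i).vcost * (q i + (P i).hcost)) := h1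
      _ ≤ 720 * (min c 1 / 1440 * p i * (q i + (P i).hcost)) := by gcongr
      _ = _ := by ring
  have h3 : (q i : ℝ) ≤ min c 1 / 2 * (q i + (P i).hcost) := le_of_mul_le_mul_left h2 hp0
  have h4 : min c 1 / 2 * (q i : ℝ) ≤ 1 / 2 * q i := by
    gcongr
    exact min_le_right c 1
  have h5 : min c 1 * ((P i).hcost : ℝ) ≤ c * (P i).hcost := by
    gcongr
    exact min_le_left c 1
  have h6 : ((P i).hcost : ℝ) ≤ (P i).tcost := by
    exact_mod_cast Nat.le_add_right _ _
  have h7 : c * ((P i).hcost : ℝ) ≤ c * (P i).tcost := by gcongr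
  nlinarith
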